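/- **Setting.** Let $L\ge 1$, $\gamma\in\mathbb C$, $\mu_1,\dots,\mu_L\in\mathbb C$, and put $a(u)=\sinh(u+\gamma)$, $b(u)=\sinh u$, $c=\sinh\gamma$. Let $R(u)$ be the six-vertex $R$-matrix on $\mathbb C^2\otimes\mathbb C^2$ (entries $a(u)$ on $e_0\otimes e_0$, $e_1\otimes e_1$, and the block $\begin{pmatrix} b(u)&c\\c&b(u)\end{pmatrix}$ on $e_0\otimes e_1,e_1\otimes e_0$), and let $$T(u)=\mathrm{Tr}_0\big[G_0R_{01}(u-\mu_1)\cdots R_{0L}(u-\mu_L)\big],\qquad G=\begin{pmatrix}0&1\\1&0\end{pmatrix},$$ be the anti-periodic transfer matrix on $(\mathbb C^2)^{\otimes L}$. Write $|0\rangle=e_0^{\otimes L}$, $|\bar 0\rangle=e_1^{\otimes L}$. For an eigenvalue function $\Lambda:\mathbb C\to\mathbb C$ with $u$-independent eigenvector $\Psi\neq 0$ (either $\langle\Psi|T(u)=\Lambda(u)\langle\Psi|$ for all $u$, or $\langle\Psi|$ is the Hermitian conjugate of $|\Psi\rangle$ with $T(u)|\Psi\rangle=\Lambda(u)|\Psi\rangle$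 for all $u$), put $\kappa_0=\mathcal F_0/\bar{\mathcal F}_0=\langle\Psi|0\rangle/\langle\Psi|\bar 0\rangle$, assuming $\langle\Psi|\bar 0\rangle\ne 0$. Let $Z(\lambda_1,\dots,\lambda_L)$ be the partition function of the six-vertex model on the $L\times L$ lattice with domain-wall boundaries: the sum, over all $\{0,1\}$-states of the edges for which at each vertex left $+$ top $=$ right $+$ bottom, with left boundary edges $1$, right ones $0$, top ones $0$, bottom ones $1$, of the product over the vertices $(i,j)$ of the weights at $u=\lambda_i-\mu_j$, namely $a(u)$ if left $=$ top, $b(u)$ if left $=$ right $\neq$ top, and $c$ if left $\ne$ right. For $n\ge 0$, $1\le i\le n$ (resp. $1\le i<j\le n$) and $x_0,\dots,x_n\in\mathbb C$, let $M_i^{(n)}=m(x_i,x_0)+m(x_0,x_i)$ and $N_{j,i}^{(n)}=\nu(j,i)+\nu(i,j)$, where $$m(p,q)=\frac{c}{b(p-q)}\prod_{\substack{1\le k\le n\\ k\ne i}}\frac{a(p-x_k)}{b(p-x_k)}\frac{a(x_k-q)}{b(x_k-q)}\prod_{l=1}^L a(q-\mu_l)b(p-\mu_l),$$ $$\nu(j,i)=\frac{c}{a(x_j-x_0)}\frac{c}{a(x_0-x_i)}\frac{a(x_j-x_i)}{b(x_j-x_i)}\prod_{\substack{0\le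 k\le n\\ k\ne i,j}}\frac{a(x_j-x_k)}{b(x_j-x_k)}\frac{a(x_k-x_i)}{b(x_k-x_i)}\prod_{l=1}^L a(x_i-\mu_l)b(x_j-\mu_l)$$ (the zeros of the denominators $a(x_j-x_0)$, $a(x_0-x_i)$ cancel). For $L\ge 3$ and spectral parameters $\lambda_0,\dots,\lambda_{L-1}$ let $\mathcal H_L$ be the following square matrix of size $3\cdot 2^{L-2}-2$. Its columns are labelled by formal unknowns $\mathcal F(X)$, where $X\subset\{\lambda_0,\dots,\lambda_{L-1}\}$ has $L-m$ elements and $X\not\ni\lambda_0$ if $m$ is odd, taken in the order $m=L,L-1,\dots,2$ and, for fixed $m$, in lexicographic order of the removed indices. For $Y=\{\lambda_{y_0},\dots,\lambda_{y_n}\}$ with $y_0<\dots<y_n$ let $E_Y$ be the linear form $$E_Y=\Lambda(\lambda_{y_0})\mathcal F(Y\setminus\{\lambda_{y_0}\})-\sum_{1\le i\le n}M_i^{(n)}\mathcal F(Y\setminus\{\lambda_{y_0},\lambda_{y_i}\})-\sum_{1\le i<j\le n}N_{j,i}^{(n)}\mathcal F(Y\setminus\{\lambda_{y_i},\lambda_{y_j}\}),$$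 with $M,N$ evaluated at $(\lambda_{y_0},\dots,\lambda_{y_n})$. If the unknown in column $r+1$ is $\mathcal F(Y)$, row $r$ of $\mathcal H_L$ consists of the coefficients of $E_Y-\mathcal F(Y)$. The last row consists of the coefficients of $$\Lambda(\lambda_0)E_{\{\lambda_1,\dots,\lambda_{L-1}\}}+E_{\{\lambda_0,\dots,\lambda_{L-1}\}}-\Lambda(\lambda_0)\mathcal F(\{\lambda_1,\dots,\lambda_{L-1}\}).$$ For $L=2$ let $\mathcal H_2=\begin{pmatrix}\Lambda(\lambda_1)&1\\ M_1^{(1)}(\lambda_0,\lambda_1)&\Lambda(\lambda_0)\end{pmatrix}$. **Statement.** Specialize the spectral parameters to the inhomogeneities: $\lambda_j=\mu_{j+1}$ $(0\le j\le L-1)$ in $\mathcal H_L$ and $\lambda_j=\mu_j$ $(1\le j\le L)$ in $Z$. Then: 1. If $L\ge 2$ and $b(\mu_i-\mu_j)\ne 0$ for $i\neq j$, then $\det\mathcal H_L=\prod_{j=1}^L\Lambda(\mu_j)$ (this holds for every function $\Lambda:\mathbb C\to\mathbb C$). 2. There is one configuration such that every other configuration has weight $0$; its weight is $c^L\prod_{1\le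 i<j\le L}a(\mu_i-\mu_j)a(\mu_j-\mu_i)$. Consequently $$Z(\mu_1,\dots,\mu_L)=c^L\prod_{1\le i<j\le L}a(\mu_i-\mu_j)\,a(\mu_j-\mu_i).$$ 3. For every eigenvalue $\Lambda$ of $T$ and eigenvector $\Psi$ as above with $\langle\Psi|\bar 0\rangle\neq0$ one has $Z(\mu_1,\dots,\mu_L)=\kappa_0\prod_{j=1}^L\Lambda(\mu_j)$, and hence, if $\prod_{j}\Lambda(\mu_j)\ne 0$, $$\kappa_0=c^L\,\frac{\prod_{1\le i<j\le L}a(\mu_i-\mu_j)\,a(\mu_j-\mu_i)}{\prod_{1\le i\le L}\Lambda(\mu_i)}.$$ -/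

import Mathlib

noncomputable section

namespace SixVertex

/-! Boltzmann weights. -/

/-- `a(u) = sinh (u + γ)`. -/
def wa (γ u : ℂ) : ℂ := Complex.sinh (u + γ)

/-- `b(u) = sinh u`. -/
def wb (u : ℂ) : ℂ := Complex.sinh u

/-- `c = sinh γ` (constant in the spectral parameter). -/
def wc (γ : ℂ) : ℂ := Complex.sinh γ

/-- The six-vertex `R`-matrix on `ℂ² ⊗ ℂ²` in the standard basis: the non-zero entries are
`a` on `(0,0)` and `(1,1)`, and the block with rows `(b, c)`, `(c, b)` on `(0,1), (1,0)`. -/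
def rMatrix (γ u : ℂ) : Matrix (Fin 2 × Fin 2) (Fin 2 × Fin 2) ℂ :=
  Matrix.of fun p q =>
    if p = q then (if p.1 = p.2 then wa γ u else wb u)
    else if p = q.swap then wc γ
    else 0

/-! The transfer matrix of the anti-periodic six-vertex model. The space `(ℂ²)^{⊗ L}` is
written in its standard basis, which is indexed by `s : Fin L → Fin 2` (`0` is spin up,
`1` is spin down); `Fin 2 × (Fin L → Fin 2)` indexes the basis of `ℂ² ⊗ (ℂ²)^{⊗ L}`, the first
factor being the auxiliary space. -/

/-- `R_{0j}(u)`: the `R`-matrix acting on the auxiliary space and on site `j`. -/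
def rSite {L : ℕ} (γ u : ℂ) (j : Fin L) :
    Matrix (Fin 2 × (Fin L → Fin 2)) (Fin 2 × (Fin L → Fin 2)) ℂ :=
  Matrix.of fun p q =>
    if ∀ k, k ≠ j → p.2 k = q.2 k then rMatrix γ u (p.1, p.2 j) (q.1, q.2 j) else 0

/-- The monodromy matrix `R_{01}(u - μ₁) R_{02}(u - μ₂) ⋯ R_{0L}(u - μ_L)`. -/
def monodromy {L : ℕ} (γ : ℂ) (mu : Fin L → ℂ) (u : ℂ) :
    Matrix (Fin 2 × (Fin L → Fin 2)) (Fin 2 × (Fin L → Fin 2)) ℂ :=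
  (List.ofFn fun j : Fin L => rSite γ (u - mu j) j).prod

/-- The off-diagonal twist `G` with rows `(0, 1)` and `(1, 0)`. -/
def twist : Matrix (Fin 2) (Fin 2) ℂ := !![0, 1; 1, 0]

/-- The anti-periodic transfer matrix `T(u)`: the trace over the auxiliary space of
`(G ⊗ 1)` times the monodromy matrix. -/
def transferMatrix {L : ℕ} (γ : ℂ) (mu : Fin L → ℂ) (u : ℂ) :
    Matrix (Fin L → Fin 2) (Fin L → Fin 2) ℂ :=
  Matrix.of fun s t => ∑ α : Fin 2, ∑ β : Fin 2, twist α β * monodromy γ mu u (β, s) (α, t)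

/-- `|0⟩`, all spins up: the highest weight vector. -/
def ketUp (L : ℕ) : (Fin L → Fin 2) → ℂ := Pi.single (fun _ => 0) 1

/-- `|0̄⟩`, all spins down: the lowest weight vector. -/
def ketDown (L : ℕ) : (Fin L → Fin 2) → ℂ := Pi.single (fun _ => 1) 1

open Matrix in
/-- `Ψ` is a ket with `T(u)|Ψ⟩ = Λ(u)|Ψ⟩` for all `u` (`Ψ` does not depend on `u`). -/
def IsEigenket {L : ℕ} (γ : ℂ) (mu : Fin L → ℂ) (Lam : ℂ → ℂ) (Psi : (Fin L → Fin 2) → ℂ) :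
    Prop :=
  Psi ≠ 0 ∧ ∀ u, transferMatrix γ mu u *ᵥ Psi = Lam u • Psi

open Matrix in
/-- `Φ` is a bra with `⟨Φ|T(u) = Λ(u)⟨Φ|` for all `u` (`Φ` does not depend on `u`). -/
def IsEigenbra {L : ℕ} (γ : ℂ) (mu : Fin L → ℂ) (Lam : ℂ → ℂ) (Phi : (Fin L → Fin 2) → ℂ) :
    Prop :=
  Phi ≠ 0 ∧ ∀ u, Phi ᵥ* transferMatrix γ mu u = Lam u • Phi

open Matrix in
/-- `𝓕₀ = ⟨Φ|0⟩` for a bra `Φ`. -/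
def overlapUp {L : ℕ} (Phi : (Fin L → Fin 2) → ℂ) : ℂ := Phi ⬝ᵥ ketUp L

open Matrix in
/-- `𝓕̄₀ = ⟨Φ|0̄⟩` for a bra `Φ`. -/
def overlapDown {L : ℕ} (Phi : (Fin L → Fin 2) → ℂ) : ℂ := Phi ⬝ᵥ ketDown L

/-- `κ₀ = 𝓕₀ / 𝓕̄₀ = ⟨Φ|0⟩ / ⟨Φ|0̄⟩`. -/
def kappa0 {L : ℕ} (Phi : (Fin L → Fin 2) → ℂ) : ℂ := overlapUp Phi / overlapDown Phi

/-! The partition function with domain-wall boundaries. -/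

/-- States of the horizontal and vertical edges of the `L × L` square lattice.
Vertex `(i, j)` has left edge `C.1 i j.castSucc`, right edge `C.1 i j.succ`, upper edge
`C.2 i.castSucc j` and lower edge `C.2 i.succ j`. The conditions are the ice rule at each
vertex and the domain-wall boundary conditions. -/
def IsDomainWall {L : ℕ} (C : (Fin L → Fin (L + 1) → Fin 2) × (Fin (L + 1) → Fin L → Fin 2)) :
    Prop :=
  (∀ i j, (C.1 i j.castSucc : ℕ) + C.2 i.castSucc j = (C.1 i j.succ : ℕ) + C.2 i.succ j) ∧
  (∀ i, C.1 i 0 = 1 ∧ C.1 i (Fin.last L) = 0) ∧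
  (∀ j, C.2 0 j = 0 ∧ C.2 (Fin.last L) j = 1)

instance {L : ℕ} : DecidablePred (IsDomainWall (L := L)) := fun _ => by
  unfold IsDomainWall; infer_instance

/-- Six-vertex configurations on the `L × L` lattice with domain-wall boundaries. -/
abbrev DWConfig (L : ℕ) : Type :=
  {C : (Fin L → Fin (L + 1) → Fin 2) × (Fin (L + 1) → Fin L → Fin 2) // IsDomainWall C}

/-- The weight of a configuration: the product over all vertices `(i, j)` of the statistical
weight `a`, `b` or `c` at spectral parameter `λ_i - μ_j`, read off from the `R`-matrix. -/
def DWConfig.weight {L : ℕ} (γ : ℂ) (mu lam : Fin L → ℂ) (C : DWConfig L) : ℂ :=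
  ∏ i : Fin L, ∏ j : Fin L,
    rMatrix γ (lam i - mu j) (C.1.1 i j.succ, C.1.2 i.succ j)
      (C.1.1 i j.castSucc, C.1.2 i.castSucc j)

/-- The partition function `Z(λ₁, …, λ_L)` with domain-wall boundaries. -/
def partitionZ {L : ℕ} (γ : ℂ) (mu lam : Fin L → ℂ) : ℂ :=
  ∑ C : DWConfig L, C.weight γ mu lam

/-! The coefficient functions `M` and `N`. -/

/-- The first summand of `M_i^{(n)}` as a function of `p = i`, `q = 0`; the second summand is
obtained by interchanging `λ_i` and `λ_0`. -/
def coeffMAux {L : ℕ} (γ : ℂ) (mu : Fin L → ℂ) {n : ℕ} (x : Fin (n + 1) → ℂ) (i : Fin n)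
    (p q : Fin (n + 1)) : ℂ :=
  wc γ / wb (x p - x q) *
    (∏ k ∈ Finset.univ.erase i,
      wa γ (x p - x k.succ) / wb (x p - x k.succ) *
        (wa γ (x k.succ - x q) / wb (x k.succ - x q))) *
    ∏ l : Fin L, (wa γ (x q - mu l) * wb (x p - mu l))

/-- `M_{i+1}^{(n)}(x_0, …, x_n)` for `i = 0, …, n - 1`. -/
def coeffM {L : ℕ} (γ : ℂ) (mu : Fin L → ℂ) {n : ℕ} (x : Fin (n + 1) → ℂ) (i : Fin n) : ℂ :=
  coeffMAux γ mu x i i.succ 0 + coeffMAux γ mu x i 0 i.succ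

/-- The first summand of `N_{j,i}^{(n)}`, with `j, i ∈ {0, …, n}`; the second summand is
obtained by interchanging `j` and `i`. -/
def coeffNAux {L : ℕ} (γ : ℂ) (mu : Fin L → ℂ) {n : ℕ} (x : Fin (n + 1) → ℂ)
    (j i : Fin (n + 1)) : ℂ :=
  wc γ / wa γ (x j - x 0) * (wc γ / wa γ (x 0 - x i)) *
    (wa γ (x j - x i) / wb (x j - x i)) *
    (∏ k ∈ (Finset.univ.erase i).erase j,
      wa γ (x j - x k) / wb (x j - x k) * (wa γ (x k - x i) / wb (x k - x i))) *
    ∏ l : Fin L, (wa γ (x i - mu l) * wb (x j - mu l))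

/-- `N_{j+1,i+1}^{(n)}(x_0, …, x_n)` for `0 ≤ i < j ≤ n - 1`. -/
def coeffN {L : ℕ} (γ : ℂ) (mu : Fin L → ℂ) {n : ℕ} (x : Fin (n + 1) → ℂ) (j i : Fin n) : ℂ :=
  coeffNAux γ mu x j.succ i.succ + coeffNAux γ mu x i.succ j.succ

/-! The matrix `𝓗_L`. A set of spectral parameters `X` is given by the increasing list of the
indices of its elements; indices run over `Fin L`, that is from `0` to `L - 1`. -/

/-- The coefficient of `𝓕(S)` in the linear form
`Λ(λ_{y₀}) 𝓕_n(y₁,…,y_n) - ∑ M_i^{(n)} 𝓕_{n-1}(y₁,…,ŷ_i,…,y_n)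
  - ∑_{i<j} N_{j,i}^{(n)} 𝓕_{n-1}(y₀,…,ŷ_i,…,ŷ_j,…,y_n)`
where `Y = [y₀, y₁, …, y_n]` and `M`, `N` have the arguments `λ_{y₀}, …, λ_{y_n}`. -/
def stepCoeff {L : ℕ} (γ : ℂ) (mu : Fin L → ℂ) (Lam : ℂ → ℂ) (lam : Fin L → ℂ) :
    List (Fin L) → List (Fin L) → ℂ
  | [], _ => 0
  | y :: Y, S =>
    let x : Fin (Y.length + 1) → ℂ := fun k => lam ((y :: Y).get k)
    (if S = Y then Lam (lam y) else 0)
      - (∑ i : Fin Y.length, if S = Y.eraseIdx i then coeffM γ mu x i else 0)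
      - ∑ i : Fin Y.length, ∑ j ∈ Finset.Ioi i,
          if S = y :: (Y.eraseIdx j).eraseIdx i then coeffN γ mu x j i else 0

/-- The unknowns `𝓕_{L-m}(X)`, `m = L, L-1, …, 2`, that label the columns of `𝓗_L`, in this
order: `X` runs over the `(L-m)`-element subsets of `{λ_0, …, λ_{L-1}}` for even `m` and of
`{λ_1, …, λ_{L-1}}` for odd `m`, in lexicographic order of the removed indices
(`List.sublistsLen` lists them in this order). Here `n = L - m`. -/
def unknowns (L : ℕ) : List (List (Fin L)) :=
  (List.range (L - 1)).flatMap fun n =>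
    List.sublistsLen n (if Even (L - n) then List.finRange L else (List.finRange L).tail)

/-- The block-tridiagonal matrix `𝓗_L` (for `L ≥ 3`). The row before the last one that is
paired by the blocks `𝒜₊ = -1` with the unknown `𝓕_{n+1}(Y)` is the functional equation
expressing `𝓕_{n+1}(Y)` through `𝓕_n` (block `𝒜₀`) and `𝓕_{n-1}` (block `𝒜₋`). The last row is
`(𝒜₋⁽²⁾, 𝒜₀⁽²⁾)`: `Λ(λ_0)` times the coefficients of the expression of `𝓕_{L-1}(X^{1,L-1})`
plus the `-M^{(L-1)}` and `-N^{(L-1)}` of the equation containing `Z`. (No column carries a list of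
length `L - 1`, so that the summand with `Λ` in the second `stepCoeff` of the last row is `0`.) -/
def hMatrix {L : ℕ} (γ : ℂ) (mu : Fin L → ℂ) (Lam : ℂ → ℂ) (lam : Fin L → ℂ) :
    Matrix (Fin (unknowns L).length) (Fin (unknowns L).length) ℂ :=
  Matrix.of fun r s =>
    let S := (unknowns L).get s
    if h : (r : ℕ) + 1 < (unknowns L).length then
      let Y := (unknowns L).get ⟨r + 1, h⟩
      stepCoeff γ mu Lam lam Y S - (if S = Y then 1 else 0)
    else
      match List.finRange L with
      | [] => 0
      | z :: X => Lam (lam z) * stepCoeff γ mu Lam lam X S + stepCoeff γ mu Lam lam (z :: X) S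

/-- The `2 × 2` matrix that replaces `𝓗_L` for `L = 2`. -/
def hMatrixTwo {L : ℕ} (γ : ℂ) (mu : Fin L → ℂ) (Lam : ℂ → ℂ) (lam : Fin 2 → ℂ) :
    Matrix (Fin 2) (Fin 2) ℂ :=
  !![Lam (lam 1), 1; coeffM γ mu (n := 1) lam 0, Lam (lam 0)]

end SixVertex

end

namespace SixVertex

open Finset Matrix

/-! At spectral parameter `μ_j`, the vertex in column `j` carries `R(0) = c P`, with `P` the
permutation. Take a row whose upper edges are `σ` before column `j` and `τ` from `j` on, and whose
outer horizontal edges differ. The swap at `j` and the ice rule then fix every other edge: the lower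
edges are `σ` up to and including `j`, and the weight is `c ∏_{k≠j} a(μ_j - μ_k)`. So the step
boundary moves one site (`step_of_top`, `step_of_bottom`).

This rigidity gives both formulas. Stacking the rows leaves one domain-wall configuration. For an
eigenvector, `T(μ_j)` relates the components at two consecutive step states, and multiplying the `L`
relations links all-`σ` to all-`τ` through `∏ Λ(μ_j)` and the same product of row weights.

The determinant is separate: at `λ_j = μ_{j+1}` all `M` and `N` vanish. What remains of `𝓗_L` is a
Hessenberg matrix whose rows, except the last, annihilate `𝓕(X) = ∏_{x∈X} Λ(x)`; Cramer's rule reads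
off the determinant from the last row (`det_of_hessenberg`). -/

/-! ### The six-vertex `R`-matrix -/

lemma rMatrix_same_left (γ u : ℂ) (σ : Fin 2) (q : Fin 2 × Fin 2) :
    rMatrix γ u (σ, σ) q = if q = (σ, σ) then wa γ u else 0 := by
  obtain ⟨x, y⟩ := q
  fin_cases σ <;> fin_cases x <;> fin_cases y <;> simp [rMatrix]

lemma rMatrix_comm (γ u : ℂ) (p q : Fin 2 × Fin 2) : rMatrix γ u p q = rMatrix γ u q p := by
  obtain ⟨x, y⟩ := q
  obtain ⟨z, w⟩ := p
  fin_cases z <;> fin_cases w <;> fin_cases x <;> fin_cases y <;> simp [rMatrix]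

lemma rMatrix_same_right (γ u : ℂ) (σ : Fin 2) (p : Fin 2 × Fin 2) :
    rMatrix γ u p (σ, σ) = if p = (σ, σ) then wa γ u else 0 := by
  rw [rMatrix_comm, rMatrix_same_left]

lemma rMatrix_zero (γ : ℂ) (p q : Fin 2 × Fin 2) :
    rMatrix γ 0 p q = if p = q.swap then wc γ else 0 := by
  obtain ⟨x, y⟩ := q
  obtain ⟨z, w⟩ := p
  fin_cases z <;> fin_cases w <;> fin_cases x <;> fin_cases y <;> simp [rMatrix, wa, wb, wc]

/-! ### Rows of the lattice -/

/-- The weight of a row of vertices with horizontal edges `h`, upper edges `s`, lower edges `t`. -/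
noncomputable def rowWeight {L : ℕ} (γ : ℂ) (mu : Fin L → ℂ) (u : ℂ) (h : Fin (L + 1) → Fin 2)
    (s t : Fin L → Fin 2) : ℂ :=
  ∏ k, rMatrix γ (u - mu k) (h k.castSucc, s k) (h k.succ, t k)

/-- The first `m` entries are `σ`, the other ones `τ`. -/
def stepState {L : ℕ} (σ τ : Fin 2) (m : ℕ) (k : Fin L) : Fin 2 := if (k : ℕ) < m then σ else τ

/-- The weight of the only row that connects two consecutive step states. -/
noncomputable def stepWeight {L : ℕ} (γ : ℂ) (mu : Fin L → ℂ) (j : Fin L) : ℂ :=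
  wc γ * ∏ k ∈ {j}ᶜ, wa γ (mu j - mu k)

/-- Each unordered pair of distinct sites occurs twice, once in the weight of either site. -/
lemma prod_stepWeight {L : ℕ} (γ : ℂ) (mu : Fin L → ℂ) :
    ∏ j, stepWeight γ mu j = wc γ ^ L *
      ∏ i, ∏ j ∈ Ioi i, (wa γ (mu i - mu j) * wa γ (mu j - mu i)) := by
  simp_rw [stepWeight, prod_mul_distrib (f := fun _ => wc γ)]
  rw [← prod_prod_Ioi_mul_eq_prod_prod_off_diag (fun k j => wa γ (mu j - mu k))]
  simp

/-- At column `j` the permutation contributes `c`; in every other column the left and upper edges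
agree, which gives `a`. -/
lemma rowWeight_step {L : ℕ} (γ : ℂ) (mu : Fin L → ℂ) (j : Fin L) (σ τ : Fin 2) :
    rowWeight γ mu (mu j) (stepState σ τ (j + 1)) (stepState σ τ j) (stepState σ τ (j + 1)) =
      stepWeight γ mu j := by
  rw [rowWeight, stepWeight, Fintype.prod_eq_mul_prod_compl j]
  congr 1
  · simp [rMatrix_zero, stepState]
  · refine prod_congr rfl fun k hk => ?_
    have hk : (k : ℕ) ≠ j := fun h => by simp [Fin.ext h] at hk
    rcases lt_or_gt_of_ne hk with h | h
    · simp [stepState, rMatrix_same_left, h, Nat.lt_succ_of_lt h]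
    · simp [stepState, rMatrix_same_left, h.not_gt, Nat.not_lt.2 h]

lemma eq_left_of_ne {σ τ x y : Fin 2} (h : σ ≠ τ) (hx : x ≠ y) (hy : y = τ) : x = σ := by
  omega

lemma eq_right_of_ne {σ τ x y : Fin 2} (h : σ ≠ τ) (hx : x ≠ y) (hy : x = σ) : y = τ := by
  omega

/-! ### Rigidity of rows with non-zero weight -/

section Rigidity

variable {L : ℕ} {γ : ℂ} {mu : Fin L → ℂ} {u : ℂ} {h : Fin (L + 1) → Fin 2} {s t : Fin L → Fin 2}

lemma rMatrix_ne_zero_of_rowWeight_ne_zero (hw : rowWeight γ mu u h s t ≠ 0) (k : Fin L) :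
    rMatrix γ (u - mu k) (h k.castSucc, s k) (h k.succ, t k) ≠ 0 :=
  prod_ne_zero_iff.1 hw k (mem_univ k)

lemma eq_of_rowWeight_ne_zero_of_top (hw : rowWeight γ mu u h s t ≠ 0) {k : Fin L} {σ : Fin 2}
    (h1 : h k.castSucc = σ) (h2 : s k = σ) : h k.succ = σ ∧ t k = σ := by
  have := rMatrix_ne_zero_of_rowWeight_ne_zero hw k
  rw [h1, h2, rMatrix_same_left] at this
  simpa using (ite_ne_right_iff.1 this).1

lemma eq_of_rowWeight_ne_zero_of_bottom (hw : rowWeight γ mu u h s t ≠ 0) {k : Fin L} {σ : Fin 2}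
    (h1 : h k.succ = σ) (h2 : t k = σ) : h k.castSucc = σ ∧ s k = σ := by
  have := rMatrix_ne_zero_of_rowWeight_ne_zero hw k
  rw [h1, h2, rMatrix_same_right] at this
  simpa using (ite_ne_right_iff.1 this).1

lemma eq_of_rowWeight_ne_zero_of_diag {j : Fin L} (hw : rowWeight γ mu (mu j) h s t ≠ 0) :
    h j.castSucc = t j ∧ h j.succ = s j := by
  have := rMatrix_ne_zero_of_rowWeight_ne_zero hw j
  rw [sub_self, rMatrix_zero] at this
  have := (ite_ne_right_iff.1 this).1
  simp only [Prod.swap_prod_mk, Prod.mk.injEq] at this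
  exact ⟨this.1, this.2.symm⟩

/-- Propagation to the right along a stretch of constant upper edges. -/
lemma forward_of_top (hw : rowWeight γ mu u h s t ≠ 0) {σ : Fin 2} {m n : ℕ}
    (hm : ∀ k : Fin (L + 1), (k : ℕ) = m → h k = σ)
    (hs : ∀ k : Fin L, m ≤ (k : ℕ) → (k : ℕ) < n → s k = σ) :
    (∀ k : Fin (L + 1), m ≤ (k : ℕ) → (k : ℕ) ≤ n → h k = σ) ∧
      ∀ k : Fin L, m ≤ (k : ℕ) → (k : ℕ) < n → t k = σ := by
  have key : ∀ k : Fin (L + 1), m ≤ (k : ℕ) → (k : ℕ) ≤ n → h k = σ := by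
    intro k
    induction k using Fin.induction with
    | zero => exact fun h0 _ => hm 0 ((Nat.le_zero.1 h0).symm)
    | succ k ih =>
      intro h0 h1
      rw [Fin.val_succ] at h0 h1
      rcases h0.eq_or_lt with h0 | h0
      · exact hm _ (by simp [h0])
      · exact (eq_of_rowWeight_ne_zero_of_top hw
          (ih (by simpa using Nat.lt_succ_iff.1 h0) (by simpa using (Nat.lt_of_succ_le h1).le))
          (hs k (by omega) (by omega))).1
  exact ⟨key, fun k h0 h1 => (eq_of_rowWeight_ne_zero_of_top hw
    (key k.castSucc (by simpa) (by simpa using h1.le)) (hs k h0 h1)).2⟩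

/-- Propagation to the left along a stretch of constant lower edges. -/
lemma backward_of_bottom (hw : rowWeight γ mu u h s t ≠ 0) {σ : Fin 2} {m n : ℕ}
    (hn : ∀ k : Fin (L + 1), (k : ℕ) = n → h k = σ) (hL : n ≤ L)
    (ht : ∀ k : Fin L, m ≤ (k : ℕ) → (k : ℕ) < n → t k = σ) :
    (∀ k : Fin (L + 1), m ≤ (k : ℕ) → (k : ℕ) ≤ n → h k = σ) ∧
      ∀ k : Fin L, m ≤ (k : ℕ) → (k : ℕ) < n → s k = σ := by
  have key : ∀ k : Fin (L + 1), m ≤ (k : ℕ) → (k : ℕ) ≤ n → h k = σ := by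
    intro k
    induction k using Fin.reverseInduction with
    | last => exact fun _ h0 => hn _ (le_antisymm h0 (by simpa using hL))
    | cast k ih =>
      intro h0 h1
      rw [Fin.val_castSucc] at h0 h1
      rcases h1.eq_or_lt with h1 | h1
      · exact hn _ (by simp [h1])
      · exact (eq_of_rowWeight_ne_zero_of_bottom hw
          (ih (by rw [Fin.val_succ]; omega) (by rw [Fin.val_succ]; omega))
          (ht k (by omega) (by omega))).1
  exact ⟨key, fun k h0 h1 => (eq_of_rowWeight_ne_zero_of_bottom hw
    (key k.succ (by rw [Fin.val_succ]; omega) (by rw [Fin.val_succ]; omega)) (ht k h0 h1)).2⟩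

lemma eq_stepState_of_lt_of_le {L : ℕ} {f : Fin L → Fin 2} {σ τ : Fin 2} {m : ℕ}
    (h1 : ∀ k : Fin L, (k : ℕ) < m → f k = σ) (h2 : ∀ k : Fin L, m ≤ (k : ℕ) → f k = τ) :
    f = stepState σ τ m := by
  funext k
  unfold stepState
  split_ifs with h
  exacts [h1 k h, h2 k (not_lt.1 h)]

/-- The swap at `j` sends the upper edge `τ` out to the right, where it meets only upper edges `τ`;
two equal incoming edges force equal outgoing ones. -/
lemma step_of_top {j : Fin L} {σ τ : Fin 2} (hστ : σ ≠ τ) (hh : h 0 ≠ h (Fin.last L))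
    (hs : s = stepState σ τ j) (hw : rowWeight γ mu (mu j) h s t ≠ 0) :
    h = stepState σ τ (j + 1) ∧ t = stepState σ τ (j + 1) := by
  obtain ⟨d1, d2⟩ := eq_of_rowWeight_ne_zero_of_diag hw
  obtain ⟨r1, r2⟩ := forward_of_top (σ := τ) (m := j + 1) (n := L) hw
    (fun k hk => by
      rw [show k = j.succ from Fin.ext (by simpa using hk), d2, hs]; simp [stepState])
    (fun k hk _ => by rw [hs, stepState, if_neg (by omega)])
  -- The right stretch has fixed the last horizontal edge to be `τ`, so `hh` makes the first one
  -- `σ`, and propagation can start again from the left end.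
  obtain ⟨l1, l2⟩ := forward_of_top (σ := σ) (m := 0) (n := j) hw
    (fun k hk => by
      rw [show k = 0 from Fin.ext (by simpa using hk)]
      exact eq_left_of_ne hστ hh (r1 _ (by simp) (by simp)))
    (fun k _ hk => by rw [hs, stepState, if_pos hk])
  refine ⟨eq_stepState_of_lt_of_le (fun k hk => l1 k (Nat.zero_le _) (by omega))
    (fun k hk => r1 k hk (by omega)), eq_stepState_of_lt_of_le (fun k hk => ?_)
    (fun k hk => r2 k hk k.2)⟩
  rcases (Nat.lt_succ_iff.1 hk).eq_or_lt with h0 | h0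
  · rw [Fin.ext h0, ← d1]; exact l1 _ (Nat.zero_le _) (by simp)
  · exact l2 k (Nat.zero_le _) h0

/-- The mirror image, needed for bras: propagation runs leftwards, and the stretch left of `j` is
settled first. -/
lemma step_of_bottom {j : Fin L} {σ τ : Fin 2} (hστ : σ ≠ τ) (hh : h 0 ≠ h (Fin.last L))
    (ht : t = stepState σ τ (j + 1)) (hw : rowWeight γ mu (mu j) h s t ≠ 0) :
    h = stepState σ τ (j + 1) ∧ s = stepState σ τ j := by
  obtain ⟨d1, d2⟩ := eq_of_rowWeight_ne_zero_of_diag hw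
  obtain ⟨l1, l2⟩ := backward_of_bottom (σ := σ) (m := 0) (n := j) hw
    (fun k hk => by
      rw [show k = j.castSucc from Fin.ext (by simpa using hk), d1, ht]; simp [stepState])
    j.2.le (fun k _ hk => by rw [ht, stepState, if_pos (by omega)])
  obtain ⟨r1, r2⟩ := backward_of_bottom (σ := τ) (m := j + 1) (n := L) hw
    (fun k hk => by
      rw [show k = Fin.last L from Fin.ext (by simpa using hk)]
      exact eq_right_of_ne hστ hh (l1 _ (by simp) (by simp)))
    le_rfl (fun k hk _ => by rw [ht, stepState, if_neg (by omega)])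
  refine ⟨eq_stepState_of_lt_of_le (fun k hk => l1 k (Nat.zero_le _) (by omega))
    (fun k hk => r1 k hk (by omega)), eq_stepState_of_lt_of_le (fun k hk => l2 k (Nat.zero_le _) hk)
    (fun k hk => ?_)⟩
  rcases hk.eq_or_lt with h0 | h0
  · rw [← Fin.ext h0, ← d2]; exact r1 _ (by simp) (by simp)
  · exact r2 k h0 k.2

end Rigidity

/-! ### The partition function -/

/-- The configuration that survives at `λ_j = μ_j`. -/
def stepConfig (L : ℕ) : DWConfig L :=
  ⟨(fun i => stepState 1 0 (i + 1), fun i => stepState 1 0 i), by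
    refine ⟨fun i j => ?_, fun i => ⟨by simp [stepState], ?_⟩, fun j => ⟨by simp [stepState], ?_⟩⟩
    · simp only [stepState, Fin.val_castSucc, Fin.val_succ]
      split_ifs <;> first | rfl | omega
    · simp [stepState]
    · simp [stepState]⟩

lemma weight_eq_prod_rowWeight {L : ℕ} (γ : ℂ) (mu lam : Fin L → ℂ) (C : DWConfig L) :
    C.weight γ mu lam =
      ∏ i, rowWeight γ mu (lam i) (C.1.1 i) (C.1.2 i.castSucc) (C.1.2 i.succ) := by
  simp only [DWConfig.weight, rowWeight]
  exact prod_congr rfl fun i _ => prod_congr rfl fun j _ => rMatrix_comm _ _ _ _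

lemma weight_stepConfig {L : ℕ} (γ : ℂ) (mu : Fin L → ℂ) :
    (stepConfig L).weight γ mu mu = ∏ j, stepWeight γ mu j := by
  rw [weight_eq_prod_rowWeight]
  refine prod_congr rfl fun i _ => ?_
  simpa [stepConfig] using rowWeight_step γ mu i 1 0

/-- The domain-wall boundary makes the ends of each row differ, and the top edges form the step
state of length `0`; rigidity then determines the rows one by one downwards. -/
lemma eq_stepConfig_of_weight_ne_zero {L : ℕ} (γ : ℂ) (mu : Fin L → ℂ) (C : DWConfig L)
    (hC : C.weight γ mu mu ≠ 0) : C = stepConfig L := by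
  rw [weight_eq_prod_rowWeight, prod_ne_zero_iff] at hC
  have hne : ∀ i, C.1.1 i 0 ≠ C.1.1 i (Fin.last L) := fun i => by
    rw [(C.2.2.1 i).1, (C.2.2.1 i).2]; decide
  have hv : ∀ i : Fin (L + 1), C.1.2 i = stepState 1 0 i := by
    intro i
    induction i using Fin.induction with
    | zero => funext j; simp [(C.2.2.2 j).1, stepState]
    | succ i ih =>
      simpa using (step_of_top (σ := 1) (τ := 0) (by decide) (hne i) (by simpa using ih)
        (hC i (mem_univ i))).2
  refine Subtype.ext (Prod.ext (funext fun i => ?_) (funext hv))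
  exact (step_of_top (σ := 1) (τ := 0) (by decide) (hne i) (by simpa using hv i.castSucc)
    (hC i (mem_univ i))).1

lemma partitionZ_self {L : ℕ} (γ : ℂ) (mu : Fin L → ℂ) :
    partitionZ γ mu mu = ∏ j, stepWeight γ mu j := by
  rw [partitionZ, Fintype.sum_eq_single (stepConfig L), weight_stepConfig]
  exact fun C hC => not_not.1 fun h => hC (eq_stepConfig_of_weight_ne_zero γ mu C h)

/-! ### The transfer matrix at the inhomogeneities -/

lemma prod_ofFn_apply {R : Type*} [CommSemiring R] {L d : ℕ}
    (A : Fin L → Matrix (Fin d) (Fin d) R) (x y : Fin d) :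
    (List.ofFn A).prod x y = ∑ h : Fin (L + 1) → Fin d,
      if h 0 = x ∧ h (Fin.last L) = y then ∏ k, A k (h k.castSucc) (h k.succ) else 0 := by
  induction L generalizing x with
  | zero =>
    rw [← (Equiv.funUnique (Fin 1) (Fin d)).symm.sum_comp]
    simp [Matrix.one_apply, ite_and]
  | succ L ih =>
    rw [List.ofFn_succ, List.prod_cons, Matrix.mul_apply, ← (Fin.consEquiv _).sum_comp,
      Fintype.sum_prod_type]
    simp_rw [ih, mul_sum]
    rw [sum_comm]
    -- The prepended point of the path must be `x`; the start `h 0` of the remaining path is the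
    -- intermediate index of the matrix product.
    refine Eq.trans ?_ (Fintype.sum_eq_single x ?_).symm
    · refine sum_congr rfl fun h _ => ?_
      rw [Fintype.sum_eq_single (h 0)]
      · simp [Fin.consEquiv, Fin.prod_univ_succ, ← Fin.succ_last]
      · intro z hz; simp [hz.symm]
    · intro z hz; simp [Fin.consEquiv, hz]

/-- The `R`-matrix as a `2 × 2` matrix in the auxiliary space, for a given transition of the
site. -/
noncomputable def auxMatrix (γ u : ℂ) (a b : Fin 2) : Matrix (Fin 2) (Fin 2) ℂ :=
  Matrix.of fun x y => rMatrix γ u (x, a) (y, b)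

/-- As each site is touched at most once, fixing the initial and final spins fixes all intermediate
ones, and only the auxiliary space is still summed over. -/
lemma prod_map_rSite_apply {L : ℕ} (γ : ℂ) (v : Fin L → ℂ) (l : List (Fin L)) (hl : l.Nodup)
    (x y : Fin 2) (s t : Fin L → Fin 2) :
    (l.map fun j => rSite γ (v j) j).prod (x, s) (y, t) =
      if ∀ k, k ∉ l → s k = t k then
        (l.map fun j => auxMatrix γ (v j) (s j) (t j)).prod x y else 0 := by
  induction l generalizing x s with
  | nil => simp [Matrix.one_apply, ite_and, ← funext_iff]; split_ifs <;> rfl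
  | cons j l ih =>
    obtain ⟨hj, hl⟩ := List.nodup_cons.1 hl
    rw [List.map_cons, List.prod_cons, Matrix.mul_apply, Fintype.sum_prod_type, List.map_cons,
      List.prod_cons, Matrix.mul_apply]
    simp_rw [ih hl]
    split_ifs with h
    · refine sum_congr rfl fun z _ => ?_
      -- The factor at `j` changes only site `j`, and the later factors leave it alone, so its spin
      -- must already be `t j`.
      rw [Fintype.sum_eq_single (Function.update s j (t j))]
      · rw [if_pos]
        · congr 1
          · rw [rSite, Matrix.of_apply, if_pos]
            · simp [auxMatrix]
            · intro k hk; simp [hk]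
          · refine congrArg (fun l : List (Matrix (Fin 2) (Fin 2) ℂ) => l.prod z y)
              (List.map_congr_left fun k hk => ?_)
            rw [Function.update_of_ne (fun e => hj (by rwa [← e]))]
        · intro k hk
          by_cases e : k = j
          · subst e; simp
          · rw [Function.update_of_ne e]; exact h k (by simp [e, hk])
      · intro r hr
        by_contra hne
        obtain ⟨h1, h2⟩ := mul_ne_zero_iff.1 hne
        rw [rSite, Matrix.of_apply] at h1
        have h1 := (ite_ne_right_iff.1 h1).1
        have h2 := (ite_ne_right_iff.1 h2).1
        refine hr (funext fun k => ?_)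
        by_cases e : k = j
        · subst e; simpa using h2 k hj
        · rw [Function.update_of_ne e]; exact (h1 k e).symm
    · refine sum_eq_zero fun z _ => sum_eq_zero fun r _ => ?_
      by_contra hne
      obtain ⟨h1, h2⟩ := mul_ne_zero_iff.1 hne
      rw [rSite, Matrix.of_apply] at h1
      have h1 := (ite_ne_right_iff.1 h1).1
      have h2 := (ite_ne_right_iff.1 h2).1
      refine h fun k hk => ?_
      rw [List.mem_cons, not_or] at hk
      exact (h1 k hk.1).trans (h2 k hk.2)

lemma monodromy_apply {L : ℕ} (γ : ℂ) (mu : Fin L → ℂ) (u : ℂ) (x y : Fin 2)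
    (s t : Fin L → Fin 2) :
    monodromy γ mu u (x, s) (y, t) = ∑ h : Fin (L + 1) → Fin 2,
      if h 0 = x ∧ h (Fin.last L) = y then rowWeight γ mu u h s t else 0 := by
  rw [monodromy, List.ofFn_eq_map,
    prod_map_rSite_apply γ (fun j => u - mu j) _ (List.nodup_finRange L), if_pos (by simp),
    ← List.ofFn_eq_map, prod_ofFn_apply]
  rfl

/-- The off-diagonal twist turns the closed paths of the trace into paths with different ends, which
is the condition needed for rigidity. -/
lemma transferMatrix_apply {L : ℕ} (γ : ℂ) (mu : Fin L → ℂ) (u : ℂ) (s t : Fin L → Fin 2) :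
    transferMatrix γ mu u s t = ∑ h : Fin (L + 1) → Fin 2,
      if h 0 ≠ h (Fin.last L) then rowWeight γ mu u h s t else 0 := by
  simp only [transferMatrix, Matrix.of_apply, Fin.sum_univ_two, twist, monodromy_apply]
  simp only [Matrix.cons_val', Matrix.cons_val_zero, Matrix.cons_val_one,
    Matrix.cons_val_fin_one, zero_mul, one_mul, zero_add, add_zero]
  rw [← sum_add_distrib]
  refine sum_congr rfl fun h _ => ?_
  generalize h 0 = x
  generalize h (Fin.last L) = y
  fin_cases x <;> fin_cases y <;> simp

lemma transferMatrix_top {L : ℕ} (γ : ℂ) (mu : Fin L → ℂ) {σ τ : Fin 2} (hστ : σ ≠ τ) (j : Fin L)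
    (t : Fin L → Fin 2) :
    transferMatrix γ mu (mu j) (stepState σ τ j) t =
      if t = stepState σ τ (j + 1) then stepWeight γ mu j else 0 := by
  rw [transferMatrix_apply]
  split_ifs with ht
  · rw [Fintype.sum_eq_single (stepState σ τ (j + 1)), ht, rowWeight_step, if_pos]
    · simpa [stepState] using hστ
    · intro h hh
      by_contra hne
      exact hh (step_of_top hστ (ite_ne_right_iff.1 hne).1 rfl (ite_ne_right_iff.1 hne).2).1
  · refine sum_eq_zero fun h _ => ?_
    by_contra hne
    exact ht (step_of_top hστ (ite_ne_right_iff.1 hne).1 rfl (ite_ne_right_iff.1 hne).2).2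

lemma transferMatrix_bottom {L : ℕ} (γ : ℂ) (mu : Fin L → ℂ) {σ τ : Fin 2} (hστ : σ ≠ τ)
    (j : Fin L) (s : Fin L → Fin 2) :
    transferMatrix γ mu (mu j) s (stepState σ τ (j + 1)) =
      if s = stepState σ τ j then stepWeight γ mu j else 0 := by
  split_ifs with hs
  · rw [hs, transferMatrix_top γ mu hστ, if_pos rfl]
  · rw [transferMatrix_apply]
    refine sum_eq_zero fun h _ => ?_
    by_contra hne
    exact hs (step_of_bottom hστ (ite_ne_right_iff.1 hne).1 rfl (ite_ne_right_iff.1 hne).2).2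

/-! ### Overlaps of eigenvectors -/

/-- Telescoping in cross-multiplied form, so that no eigenvalue or intermediate component has to be
non-zero. -/
lemma prod_mul_eq_prod_mul_of_step {R : Type*} [CommSemiring R] {L : ℕ} (f g : Fin L → R)
    (F : ℕ → R) (h : ∀ j : Fin L, f j * F (j + 1) = g j * F j) :
    (∏ j, f j) * F L = (∏ j, g j) * F 0 := by
  induction L with
  | zero => simp
  | succ L ih =>
    have h1 := ih (fun j => f j.castSucc) (fun j => g j.castSucc) fun j => by
      simpa using h j.castSucc
    have h2 := h (Fin.last L)
    rw [Fin.val_last] at h2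
    rw [Fin.prod_univ_castSucc, Fin.prod_univ_castSucc, mul_assoc, h2, mul_left_comm, h1]
    ring

section Eigenvector

variable {L : ℕ} {γ : ℂ} {mu : Fin L → ℂ} {Lam : ℂ → ℂ} {σ τ : Fin 2}

lemma IsEigenbra.prod_mul {Phi : (Fin L → Fin 2) → ℂ} (h : IsEigenbra γ mu Lam Phi)
    (hστ : σ ≠ τ) :
    (∏ j, Lam (mu j)) * Phi (fun _ => σ) = (∏ j, stepWeight γ mu j) * Phi (fun _ => τ) := by
  have := prod_mul_eq_prod_mul_of_step (fun j => Lam (mu j)) (stepWeight γ mu)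
    (fun m => Phi (stepState σ τ m)) fun j => by
      have := congrFun (h.2 (mu j)) (stepState σ τ (j + 1))
      simp only [Matrix.vecMul, dotProduct, transferMatrix_bottom γ mu hστ] at this
      simpa [mul_comm] using this.symm
  convert this using 3
  · funext k; simp [stepState]
  · funext k; simp [stepState]

lemma IsEigenket.prod_mul {Psi : (Fin L → Fin 2) → ℂ} (h : IsEigenket γ mu Lam Psi)
    (hστ : σ ≠ τ) :
    (∏ j, Lam (mu j)) * Psi (fun _ => τ) = (∏ j, stepWeight γ mu j) * Psi (fun _ => σ) := by
  refine Eq.symm ?_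
  have := prod_mul_eq_prod_mul_of_step (stepWeight γ mu) (fun j => Lam (mu j))
    (fun m => Psi (stepState σ τ m)) fun j => by
      have := congrFun (h.2 (mu j)) (stepState σ τ j)
      simp only [Matrix.mulVec, dotProduct, transferMatrix_top γ mu hστ] at this
      simpa using this
  convert this using 3
  · funext k; simp [stepState]
  · funext k; simp [stepState]

end Eigenvector

/-- This passes from a ket to its conjugate without conjugating `Λ`. The two relations force `P = ±
Z`, so either both vanish or `x = ± y`, and a sign is real. -/
lemma mul_star_of_mul_of_mul {P Z x y : ℂ} (h1 : P * x = Z * y) (h2 : P * y = Z * x)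
    (hy : y ≠ 0) : P * star x = Z * star y := by
  have h : (P - Z) * (P + Z) = 0 := by
    refine (mul_eq_zero.1 (?_ : (P - Z) * (P + Z) * y = 0)).resolve_right hy
    linear_combination P * h2 + Z * h1
  by_cases hP : P = 0
  · have : Z = 0 := by simpa [hP] using h
    simp [hP, this]
  rcases mul_eq_zero.1 h with h | h
  · rw [sub_eq_zero] at h
    rw [← h] at h1 ⊢
    rw [mul_left_cancel₀ hP h1]
  · rw [← neg_eq_iff_add_eq_zero] at h
    rw [← h] at h1 ⊢
    rw [neg_mul, ← mul_neg] at h1 ⊢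
    rw [mul_left_cancel₀ hP h1, star_neg]

lemma prod_mul_overlapUp {L : ℕ} {γ : ℂ} {mu : Fin L → ℂ} {Lam : ℂ → ℂ}
    {Phi : (Fin L → Fin 2) → ℂ}
    (h : IsEigenbra γ mu Lam Phi ∨ IsEigenket γ mu Lam (star Phi)) (h0 : overlapDown Phi ≠ 0) :
    (∏ j, Lam (mu j)) * overlapUp Phi = (∏ j, stepWeight γ mu j) * overlapDown Phi := by
  simp only [overlapUp, overlapDown, ketUp, ketDown, dotProduct_single, mul_one] at h0 ⊢
  rcases h with h | h
  · exact h.prod_mul (by decide)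
  -- Both orders of the two spins are used, which supplies the two relations.
  · have := mul_star_of_mul_of_mul (h.prod_mul (σ := 1) (τ := 0) (by decide))
      (h.prod_mul (σ := 0) (τ := 1) (by decide)) (by simpa using h0)
    simpa using this

/-! ### The determinant -/

/-- By Cramer's rule, `det H * v 0` is the determinant after column `0` is replaced by `H v`, which
is supported in the last row. The remaining minor is lower triangular with diagonal `-1`, so its
sign cancels the cofactor sign. -/
lemma det_of_hessenberg {R : Type*} [CommRing R] {N : ℕ} (H : Matrix (Fin N) (Fin N) R)
    (v : Fin N → R) (p : R) (hN : 0 < N)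
    (h1 : ∀ r s : Fin N, (s : ℕ) = r + 1 → H r s = -1)
    (h2 : ∀ r s : Fin N, (r : ℕ) + 1 < s → H r s = 0) (h0 : v ⟨0, hN⟩ = 1)
    (hv : ∀ r : Fin N, (H *ᵥ v) r = if (r : ℕ) + 1 < N then 0 else p) : H.det = p := by
  obtain ⟨n, rfl⟩ := Nat.exists_eq_succ_of_ne_zero hN.ne'
  have hc : H.det * v 0 = cramer H (H *ᵥ v) 0 := by
    rw [cramer_eq_adjugate_mulVec, mulVec_mulVec, adjugate_mul, smul_mulVec, one_mulVec]
    rfl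
  rw [show v 0 = 1 from h0, mul_one] at hc
  rw [hc, cramer_apply, det_succ_column_zero, Fintype.sum_eq_single (Fin.last n)]
  · have ht : ((H.updateCol 0 (H *ᵥ v)).submatrix (Fin.last n).succAbove Fin.succ).det =
        (-1) ^ n := by
      rw [det_of_isLowerTriangular]
      · simp [Fin.succ_ne_zero, h1]
      · intro i j hij
        have hij : i < j := by simpa using hij
        simp only [submatrix_apply, Fin.succAbove_last, updateCol_apply, Fin.succ_ne_zero, if_false]
        exact h2 _ _ (by simpa using hij)
    rw [ht, updateCol_self, hv]
    simp only [Fin.val_last, Nat.succ_eq_add_one, lt_irrefl, if_false]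
    rw [mul_right_comm, ← mul_pow]
    simp
  · intro i hi
    rw [updateCol_self, hv, if_pos]
    · simp
    · have := Fin.val_lt_last hi
      omega

/-! ### Vanishing of `M` and `N` at the inhomogeneities -/

lemma coeffM_eq_zero {L n : ℕ} (γ : ℂ) (mu : Fin L → ℂ) (x : Fin (n + 1) → ℂ)
    (hx : ∀ k, ∃ l, x k = mu l) (i : Fin n) : coeffM γ mu x i = 0 := by
  -- The product of the `b(x_p - μ_l)` contains `b(0) = 0`.
  have h : ∀ p q, coeffMAux γ mu x i p q = 0 := fun p q => by
    obtain ⟨l, hl⟩ := hx p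
    rw [coeffMAux, prod_eq_zero (mem_univ l) (by simp [hl, wb]), mul_zero]
  rw [coeffM, h, h, add_zero]

lemma coeffN_eq_zero {L n : ℕ} (γ : ℂ) (mu : Fin L → ℂ) (x : Fin (n + 1) → ℂ)
    (hx : ∀ k, ∃ l, x k = mu l) (j i : Fin n) : coeffN γ mu x j i = 0 := by
  have h : ∀ p q, coeffNAux γ mu x p q = 0 := fun p q => by
    obtain ⟨l, hl⟩ := hx p
    rw [coeffNAux, prod_eq_zero (mem_univ l) (by simp [hl, wb]), mul_zero]
  rw [coeffN, h, h, add_zero]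

lemma stepCoeff_cons_self {L : ℕ} (γ : ℂ) (mu : Fin L → ℂ) (Lam : ℂ → ℂ) (y : Fin L)
    (Y S : List (Fin L)) :
    stepCoeff γ mu Lam mu (y :: Y) S = if S = Y then Lam (mu y) else 0 := by
  simp only [stepCoeff]
  simp_rw [coeffM_eq_zero γ mu _ (fun _ => ⟨_, rfl⟩), coeffN_eq_zero γ mu _ (fun _ => ⟨_, rfl⟩)]
  simp

/-! ### The order of the unknowns and the resulting Hessenberg form -/

lemma mem_unknowns {L : ℕ} {Y : List (Fin L)} :
    Y ∈ unknowns L ↔ Y.length < L - 1 ∧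
      List.Sublist Y
        (if Even (L - Y.length) then List.finRange L else (List.finRange L).tail) := by
  simp only [unknowns, List.mem_flatMap, List.mem_range, List.mem_sublistsLen]
  constructor
  · rintro ⟨n, hn, h, rfl⟩
    exact ⟨hn, h⟩
  · rintro ⟨hn, h⟩
    exact ⟨_, hn, h, rfl⟩

/-- The one non-zero coefficient of the reduced form sits at the tail, which must therefore label a
column. Removing the head flips the parity; the tail of an increasing list avoids the index `0`, as
odd `m` requires. -/
lemma tail_mem_unknowns {L : ℕ} {y : Fin L} {Y : List (Fin L)} (h : y :: Y ∈ unknowns L) :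
    Y ∈ unknowns L := by
  rw [mem_unknowns, List.length_cons] at h
  obtain ⟨h1, h2⟩ := h
  rw [mem_unknowns]
  refine ⟨by omega, ?_⟩
  have h3 : L - Y.length = L - (Y.length + 1) + 1 := by omega
  by_cases he : Even (L - (Y.length + 1))
  · rw [if_pos he] at h2
    rw [h3, if_neg (by simpa [Nat.even_add_one] using he)]
    exact h2.tail
  · rw [if_neg he] at h2
    rw [h3, if_pos (by simpa [Nat.even_add_one] using he)]
    exact ((List.sublist_cons_self _ _).trans h2).trans (List.tail_sublist _)

lemma pairwise_unknowns (L : ℕ) :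
    (unknowns L).Pairwise fun S T => S ≠ T ∧ S.length ≤ T.length := by
  rw [unknowns, List.pairwise_flatMap]
  refine ⟨fun n _ => ?_, ?_⟩
  · have hn : (List.sublistsLen n
        (if Even (L - n) then List.finRange L else (List.finRange L).tail)).Nodup := by
      apply List.nodup_sublistsLen
      split_ifs
      · exact List.nodup_finRange L
      · exact (List.nodup_finRange L).tail
    refine hn.imp_of_mem fun {S T} hS hT hne => ⟨hne, ?_⟩
    rw [List.length_of_sublistsLen hS, List.length_of_sublistsLen hT]
  · refine List.pairwise_lt_range.imp fun {m n} hmn S hS T hT => ?_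
    have h1 := List.length_of_sublistsLen hS
    have h2 := List.length_of_sublistsLen hT
    exact ⟨fun h => by rw [h] at h1; omega, by omega⟩

lemma length_get_unknowns_mono {L : ℕ} {r s : Fin (unknowns L).length} (h : r < s) :
    ((unknowns L).get r).length ≤ ((unknowns L).get s).length :=
  (List.pairwise_iff_get.1 (pairwise_unknowns L) r s h).2

lemma nodup_unknowns (L : ℕ) : (unknowns L).Nodup :=
  (pairwise_unknowns L).imp fun h => h.1

lemma nil_mem_unknowns {L : ℕ} (hL : 3 ≤ L) : [] ∈ unknowns L := by
  rw [mem_unknowns]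
  exact ⟨by simp; omega, List.nil_sublist _⟩

lemma length_unknowns_pos {L : ℕ} (hL : 3 ≤ L) : 0 < (unknowns L).length :=
  List.length_pos_of_mem (nil_mem_unknowns hL)

lemma get_unknowns_eq_nil {L : ℕ} (hL : 3 ≤ L) (r : Fin (unknowns L).length) :
    (unknowns L).get r = [] ↔ (r : ℕ) = 0 := by
  obtain ⟨q, hq⟩ := List.get_of_mem (nil_mem_unknowns hL)
  have hz : (unknowns L).get ⟨0, length_unknowns_pos hL⟩ = [] := by
    rcases Nat.eq_zero_or_pos q with h | h
    · rw [← hq]; congr 1; exact Fin.ext h.symm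
    · have := length_get_unknowns_mono (r := ⟨0, length_unknowns_pos hL⟩) (s := q) h
      rw [hq] at this
      exact List.length_eq_zero_iff.1 (Nat.le_zero.1 this)
  rw [← hz, List.Nodup.get_inj_iff (nodup_unknowns L), Fin.ext_iff]

lemma sum_ite_get_eq {α R : Type*} [DecidableEq α] [CommSemiring R] {l : List α} (hl : l.Nodup)
    {Y : α} (hY : Y ∈ l) (c : R) (f : α → R) :
    ∑ s, (if l.get s = Y then c else 0) * f (l.get s) = c * f Y := by
  obtain ⟨q, rfl⟩ := List.get_of_mem hY
  rw [Fintype.sum_eq_single q]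
  · rw [if_pos rfl]
  · intro s hs
    rw [if_neg (fun h => hs (hl.get_inj_iff.1 h)), zero_mul]

lemma det_hMatrix_self {L : ℕ} (hL : 3 ≤ L) (γ : ℂ) (mu : Fin L → ℂ) (Lam : ℂ → ℂ) :
    (hMatrix γ mu Lam mu).det = ∏ j, Lam (mu j) := by
  -- The solution of the reduced recurrence `𝓕(y :: Y) = Λ(μ_y) 𝓕(Y)` with `𝓕(∅) = 1`.
  let F : List (Fin L) → ℂ := fun S => (S.map fun y => Lam (mu y)).prod
  have hrow : ∀ r s : Fin (unknowns L).length, ∀ h : (r : ℕ) + 1 < (unknowns L).length,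
      ∃ y Y, (unknowns L).get ⟨r + 1, h⟩ = y :: Y ∧ hMatrix γ mu Lam mu r s =
        (if (unknowns L).get s = Y then Lam (mu y) else 0) -
          if (unknowns L).get s = y :: Y then 1 else 0 := by
    intro r s h
    obtain ⟨y, Y, hY⟩ := List.exists_cons_of_ne_nil
      (fun e => Nat.succ_ne_zero _ ((get_unknowns_eq_nil hL ⟨r + 1, h⟩).1 e))
    refine ⟨y, Y, hY, ?_⟩
    simp only [hMatrix, Matrix.of_apply]
    rw [dif_pos h, hY, stepCoeff_cons_self]
  refine det_of_hessenberg _ (fun s => F ((unknowns L).get s)) _ (length_unknowns_pos hL)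
    ?_ ?_ ?_ ?_
  · intro r s hs
    have h : (r : ℕ) + 1 < (unknowns L).length := hs ▸ s.2
    obtain ⟨y, Y, hY, he⟩ := hrow r s h
    rw [he, show s = ⟨r + 1, h⟩ from Fin.ext hs, hY]
    simp
  · intro r s hs
    have h : (r : ℕ) + 1 < (unknowns L).length := hs.trans s.2
    obtain ⟨y, Y, hY, he⟩ := hrow r s h
    have hl := length_get_unknowns_mono (r := ⟨r + 1, h⟩) (s := s) hs
    rw [hY, List.length_cons] at hl
    rw [he, if_neg, if_neg, sub_zero]
    · rw [← hY, (nodup_unknowns L).get_inj_iff, Fin.ext_iff]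
      exact hs.ne'
    -- The tail is shorter than the list labelling column `r + 1`, while lengths never decrease
    -- along the columns.
    · intro e
      rw [e] at hl
      omega
  · have := (get_unknowns_eq_nil hL ⟨0, length_unknowns_pos hL⟩).2 rfl
    simp only [this, F, List.map_nil, List.prod_nil]
  · intro r
    simp only [Matrix.mulVec, dotProduct]
    split_ifs with h
    · obtain ⟨y, Y, hY, -⟩ := hrow r r h
      have he : ∀ s, hMatrix γ mu Lam mu r s =
          (if (unknowns L).get s = Y then Lam (mu y) else 0) -
            if (unknowns L).get s = y :: Y then 1 else 0 := by
        intro s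
        obtain ⟨y', Y', hY', he⟩ := hrow r s h
        obtain ⟨rfl, rfl⟩ := List.cons_eq_cons.1 (hY.symm.trans hY')
        exact he
      have hm : y :: Y ∈ unknowns L := hY ▸ List.get_mem _ _
      simp_rw [he, sub_mul]
      rw [sum_sub_distrib, sum_ite_get_eq (nodup_unknowns L) (tail_mem_unknowns hm),
        sum_ite_get_eq (nodup_unknowns L) hm]
      simp [F]
    -- The last row: its only entry `Λ(μ_z) Λ(μ_z')`, in the column of `X`, supplies the two factors
    -- missing from `F X`.
    · obtain ⟨z, z', X, hX⟩ : ∃ z z' X, List.finRange L = z :: z' :: X := by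
        match hf : List.finRange L with
        | [] => simp [List.finRange_eq_nil_iff] at hf; omega
        | [z] => have := congrArg List.length hf; simp at this; omega
        | z :: z' :: X => exact ⟨z, z', X, rfl⟩
      have hlen : X.length + 2 = L := by simpa using (congrArg List.length hX).symm
      have hm : X ∈ unknowns L := by
        rw [mem_unknowns]
        refine ⟨by omega, ?_⟩
        rw [show L - X.length = 2 by omega, if_pos even_two, hX]
        exact (List.sublist_cons_self _ _).trans (List.sublist_cons_self _ _)
      have he : ∀ s, hMatrix γ mu Lam mu r s =
          if (unknowns L).get s = X then Lam (mu z) * Lam (mu z') else 0 := by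
        intro s
        have hs : (unknowns L).get s ≠ z' :: X := fun e => by
          have := (mem_unknowns.1 (List.get_mem (unknowns L) s)).1
          rw [e, List.length_cons] at this
          omega
        simp only [hMatrix, Matrix.of_apply]
        rw [dif_neg h, hX]
        simp only [stepCoeff_cons_self]
        rw [if_neg hs, add_zero, mul_ite, mul_zero]
      simp_rw [he]
      rw [sum_ite_get_eq (nodup_unknowns L) hm, ← List.prod_ofFn, List.ofFn_eq_map, hX]
      simp [F, mul_assoc]

lemma det_hMatrixTwo_self (γ : ℂ) (mu : Fin 2 → ℂ) (Lam : ℂ → ℂ) :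
    (hMatrixTwo γ mu Lam mu).det = ∏ j, Lam (mu j) := by
  rw [hMatrixTwo, coeffM_eq_zero γ mu (n := 1) mu (fun k => ⟨k, rfl⟩), Matrix.det_fin_two_of,
    Fin.prod_univ_two]
  ring

end SixVertex

theorem mainTheorem2 (L : ℕ) (hL : 1 ≤ L) (γ : ℂ) (mu : Fin L → ℂ) (Lam : ℂ → ℂ) :
    -- the determinant at `λ_j = μ_j`
    ((∀ i j, i ≠ j → SixVertex.wb (mu i - mu j) ≠ 0) →
      (3 ≤ L → (SixVertex.hMatrix γ mu Lam mu).det = ∏ j, Lam (mu j)) ∧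
      (∀ h : L = 2, (SixVertex.hMatrixTwo γ mu Lam (fun i => mu (Fin.cast h.symm i))).det =
        ∏ j, Lam (mu j))) ∧
    -- only one configuration contributes to `Z` at `λ_j = μ_j`
    (∃ C₀ : SixVertex.DWConfig L,
      (∀ C : SixVertex.DWConfig L, C ≠ C₀ → C.weight γ mu mu = 0) ∧
      C₀.weight γ mu mu = SixVertex.wc γ ^ L *
        ∏ i, ∏ j ∈ Finset.Ioi i,
          (SixVertex.wa γ (mu i - mu j) * SixVertex.wa γ (mu j - mu i))) ∧
    SixVertex.partitionZ γ mu mu = SixVertex.wc γ ^ L *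
      ∏ i, ∏ j ∈ Finset.Ioi i,
        (SixVertex.wa γ (mu i - mu j) * SixVertex.wa γ (mu j - mu i)) ∧
    -- the coefficient `κ₀`
    (∀ Phi : (Fin L → Fin 2) → ℂ,
      (SixVertex.IsEigenbra γ mu Lam Phi ∨ SixVertex.IsEigenket γ mu Lam (star Phi)) →
      SixVertex.overlapDown Phi ≠ 0 →
      SixVertex.partitionZ γ mu mu = SixVertex.kappa0 Phi * ∏ j, Lam (mu j) ∧
      (∏ j, Lam (mu j) ≠ 0 →
        SixVertex.kappa0 Phi = SixVertex.wc γ ^ L *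
          (∏ i, ∏ j ∈ Finset.Ioi i,
            (SixVertex.wa γ (mu i - mu j) * SixVertex.wa γ (mu j - mu i))) /
          ∏ j, Lam (mu j))) := by
  refine ⟨fun _ => ⟨fun h => SixVertex.det_hMatrix_self h γ mu Lam, ?_⟩,
    ⟨SixVertex.stepConfig L, fun C hC => not_not.1 fun h =>
      hC (SixVertex.eq_stepConfig_of_weight_ne_zero γ mu C h), ?_⟩, ?_, fun Phi hPhi h0 => ?_⟩
  · rintro rfl
    exact SixVertex.det_hMatrixTwo_self γ mu Lam
  · rw [SixVertex.weight_stepConfig, SixVertex.prod_stepWeight]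
  · rw [SixVertex.partitionZ_self, SixVertex.prod_stepWeight]
  · have h := SixVertex.prod_mul_overlapUp hPhi h0
    refine ⟨?_, fun hP => ?_⟩
    · rw [SixVertex.partitionZ_self, SixVertex.kappa0, div_mul_eq_mul_div, eq_div_iff h0, ← h,
        mul_comm]
    · rw [← SixVertex.prod_stepWeight, SixVertex.kappa0, div_eq_div_iff h0 hP, ← h, mul_comm]
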